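/- For a group $G$ let $\langle G,G\rangle$ be the free group on all pairs $\langle x,y\rangle$ with $x,y\in G$. Write $[x,y]=xyx^{-1}y^{-1}$ and $\langle y,z\rangle^x=\langle xyx^{-1},xzx^{-1}\rangle$, and let $B(G)$ be the normal subgroup of $\langle G,G\rangle$ generated by the relations $$\langle x,x\rangle\sim 1,\qquad \langle x,y\rangle\sim\langle y,x\rangle^{-1},\qquad \langle xy,z\rangle\sim\langle y,z\rangle^x\langle x,z\rangle,\qquad \langle y,z\rangle^x\sim\langle x,[y,z]\rangle\langle y,z\rangle$$ for $x,y,z\in G$. For $a,b\in\langle G,G\rangle$ write $a\sim b$ if $a$ and $b$ have the same class in $\langle G,G\rangle/B(G)$. Proposition. Let $n\ge 4$ and $G=S_n$, and let $\sigma_i,\tau_i,\sigma'_j,\tau'_j\in S_n$ for $1\le i\le r$ and $1\le j\le s$ satisfy $$[\sigma_1,\tau_1]\cdots[\sigma_r,\tau_r]=[\sigma'_1,\tau'_1]\cdots[\sigma'_s,\tau'_s].$$ Put $u:=\langle(1,2),(3,4)\rangle$. Then there is $k\in\{0,1\}$ such that $$\langle\sigma_1,\tau_1\rangle\cdots\langle\sigma_r,\tau_r\rangle\sim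 u^k\,\langle\sigma'_1,\tau'_1\rangle\cdots\langle\sigma'_s,\tau'_s\rangle.$$ -/

import Mathlib

open scoped commutatorElement

namespace FormalPairs

variable {G : Type*} [Group G]

/-- The formal pair `⟨x, y⟩`, a generator of the free group `⟨G, G⟩` on all pairs of elements
of `G`. -/
def pair (x y : G) : FreeGroup (G × G) := FreeGroup.of (x, y)

/-- The relators, where `⟨y, z⟩ ^ x` stands for `⟨x y x⁻¹, x z x⁻¹⟩`
and `⁅y, z⁆ = y z y⁻¹ z⁻¹`. A relation `a ∼ b` is written as the relator `a * b⁻¹`. -/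
inductive IsRelator : FreeGroup (G × G) → Prop
  | self (x : G) : IsRelator (pair x x)
  | swap (x y : G) : IsRelator (pair x y * ((pair y x)⁻¹)⁻¹)
  | mul (x y z : G) :
      IsRelator (pair (x * y) z * (pair (x * y * x⁻¹) (x * z * x⁻¹) * pair x z)⁻¹)
  | conj (x y z : G) :
      IsRelator (pair (x * y * x⁻¹) (x * z * x⁻¹) * (pair x ⁅y, z⁆ * pair y z)⁻¹)

variable (G) in
/-- The normal subgroup `B(G)` of `⟨G, G⟩` generated by the relators. -/
def B : Subgroup (FreeGroup (G × G)) := Subgroup.normalClosure {w | IsRelator w}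

/-- `a ∼ b`: the two elements of `⟨G, G⟩` have the same class modulo `B(G)`. -/
def Equivalent (a b : FreeGroup (G × G)) : Prop :=
  (QuotientGroup.mk a : FreeGroup (G × G) ⧸ B G) = QuotientGroup.mk b

/-- The formal pair `u = ⟨(1 2), (3 4)⟩` for `S_n`, `n ≥ 4`; the letters `1, 2, 3, 4` are the
elements `0, 1, 2, 3` of `Fin n`. -/
def u (n : ℕ) (hn : 4 ≤ n) : FreeGroup (Equiv.Perm (Fin n) × Equiv.Perm (Fin n)) :=
  pair (Equiv.swap ⟨0, by omega⟩ ⟨1, by omega⟩) (Equiv.swap ⟨2, by omega⟩ ⟨3, by omega⟩)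

end FormalPairs

/-! The map `⟨x, y⟩ ↦ [x, y]` induces a homomorphism `∂` from the exterior square `E` to `G`, so the
claim is that for `G = S_n` its kernel is contained in `{1, u}`. With the conjugation action, `∂` is
a crossed module (`mul_eq_conjAct_mul`), so `(e, g) ↦ ∂e · g` is a homomorphism `E ⋊ G → G`. Fix a
transposition `t`. The elements `(⟨g, t⟩, t)` lift the conjugates `g t g⁻¹`, are involutions and
conjugate each other as the transpositions do. Modulo the central subgroup `N` generated by `u` they
depend only on `g t g⁻¹`, since brackets of `t` with its centralizer are powers of `u`
(`bracket_mem_zpowers_of_commute_swap`). These relations present `S_n`, so the lifts generate a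
group mapping injectively to `S_n` (`eq_one_of_mem_closure_swap_lift`). It contains the image of
`E`, because brackets of transpositions are commutators of lifts. Hence `ker ∂` dies modulo `N`;
finally `u² = 1`. -/

open scoped commutatorElement

namespace FormalPairs

/-! ### The exterior square as a crossed module -/

section Bracket

variable {G : Type*} [Group G]

instance : (B G).Normal := Subgroup.normalClosure_normal

variable (G) in
/-- The quotient `⟨G, G⟩ / B(G)`, the nonabelian exterior square of `G`. -/
abbrev ExteriorSquare : Type _ := FreeGroup (G × G) ⧸ B G

/-- The class of the formal pair `⟨x, y⟩`. -/
def bracket (x y : G) : ExteriorSquare G := QuotientGroup.mk (pair x y)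

theorem mk_eq_one_of_isRelator {w : FreeGroup (G × G)} (h : IsRelator w) :
    (QuotientGroup.mk w : ExteriorSquare G) = 1 :=
  (QuotientGroup.eq_one_iff w).2 (Subgroup.subset_normalClosure h)

theorem bracket_self (x : G) : bracket x x = 1 :=
  mk_eq_one_of_isRelator (.self x)

theorem bracket_swap (x y : G) : (bracket x y)⁻¹ = bracket y x := by
  have h := mk_eq_one_of_isRelator (IsRelator.swap y x)
  rw [QuotientGroup.mk_mul, QuotientGroup.mk_inv, QuotientGroup.mk_inv, mul_inv_eq_one] at h
  exact h.symm

theorem bracket_mul_left' (x y z : G) :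
    bracket (x * y) z = bracket (x * y * x⁻¹) (x * z * x⁻¹) * bracket x z := by
  have h := mk_eq_one_of_isRelator (IsRelator.mul x y z)
  rwa [QuotientGroup.mk_mul, QuotientGroup.mk_inv, mul_inv_eq_one] at h

theorem bracket_conj' (x y z : G) :
    bracket (x * y * x⁻¹) (x * z * x⁻¹) = bracket x ⁅y, z⁆ * bracket y z := by
  have h := mk_eq_one_of_isRelator (IsRelator.conj x y z)
  rwa [QuotientGroup.mk_mul, QuotientGroup.mk_inv, mul_inv_eq_one] at h

theorem closure_bracket :
    Subgroup.closure {e : ExteriorSquare G | ∃ x y, bracket x y = e} = ⊤ := by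
  rw [eq_top_iff]
  rintro ⟨w⟩ -
  change (QuotientGroup.mk' (B G)) w ∈ _
  induction w using FreeGroup.induction_on with
  | C1 => exact one_mem _
  | of p => exact Subgroup.subset_closure ⟨p.1, p.2, rfl⟩
  | inv_of p h => rw [map_inv]; exact inv_mem h
  | mul a b ha hb => rw [map_mul]; exact mul_mem ha hb

/-- Two homomorphisms on the exterior square agree if they agree on all brackets. -/
theorem exteriorSquare_hom_ext {H : Type*} [Group H] {f g : ExteriorSquare G →* H}
    (h : ∀ x y, f (bracket x y) = g (bracket x y)) : f = g :=
  QuotientGroup.monoidHom_ext _ (FreeGroup.ext_hom _ _ fun p => h p.1 p.2)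

variable (G) in
/-- The boundary map `⟨x, y⟩ ↦ [x, y]`. -/
def boundary : ExteriorSquare G →* G :=
  QuotientGroup.lift (B G) (FreeGroup.lift fun p : G × G => ⁅p.1, p.2⁆) <| by
    refine Subgroup.normalClosure_le_normal (N := MonoidHom.ker _) ?_
    rintro w (x | ⟨x, y⟩ | ⟨x, y, z⟩ | ⟨x, y, z⟩) <;>
      simp [pair, MonoidHom.mem_ker, commutatorElement_def, mul_assoc]

theorem boundary_bracket (x y : G) : boundary G (bracket x y) = ⁅x, y⁆ := by
  change FreeGroup.lift (fun p : G × G => ⁅p.1, p.2⁆) (FreeGroup.of (x, y)) = _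
  rw [FreeGroup.lift_apply_of]

/-- The endomorphism `⟨y, z⟩ ↦ ⟨x y x⁻¹, x z x⁻¹⟩`. -/
def conjEnd (x : G) : ExteriorSquare G →* ExteriorSquare G :=
  QuotientGroup.map (B G) (B G)
    (FreeGroup.map fun p : G × G => (x * p.1 * x⁻¹, x * p.2 * x⁻¹)) <| by
    refine Subgroup.normalClosure_le_normal (N := (B G).comap _) ?_
    have key : ∀ a b : G, FreeGroup.map (fun p : G × G => (x * p.1 * x⁻¹, x * p.2 * x⁻¹))
      (pair a b) = pair (x * a * x⁻¹) (x * b * x⁻¹) := fun a b => by simp [pair]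
    rintro w (a | ⟨a, b⟩ | ⟨a, b, c⟩ | ⟨a, b, c⟩) <;>
      refine Subgroup.subset_normalClosure ?_ <;>
      simp only [map_mul, map_inv, key, Set.mem_ofPred_eq]
    · exact .self _
    · exact .swap _ _
    · have h := IsRelator.mul (x * a * x⁻¹) (x * b * x⁻¹) (x * c * x⁻¹)
      simpa [mul_assoc] using h
    · have h := IsRelator.conj (x * a * x⁻¹) (x * b * x⁻¹) (x * c * x⁻¹)
      simpa [mul_assoc, commutatorElement_def] using h

theorem conjEnd_bracket (x y z : G) :
    conjEnd x (bracket y z) = bracket (x * y * x⁻¹) (x * z * x⁻¹) := by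
  change QuotientGroup.mk (FreeGroup.map _ (FreeGroup.of (y, z))) = _
  rw [FreeGroup.map.of]
  rfl

theorem conjEnd_one : conjEnd (1 : G) = MonoidHom.id _ :=
  exteriorSquare_hom_ext fun y z => by simp [conjEnd_bracket]

theorem conjEnd_mul (x y : G) : conjEnd (x * y) = (conjEnd x).comp (conjEnd y) :=
  exteriorSquare_hom_ext fun a b => by simp [conjEnd_bracket, mul_assoc]

variable (G) in
/-- The action of `G` on its exterior square by conjugation. -/
def conjAct : G →* MulAut (ExteriorSquare G) where
  toFun x := (conjEnd x).toMulEquiv (conjEnd x⁻¹)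
    (by rw [← conjEnd_mul, inv_mul_cancel, conjEnd_one])
    (by rw [← conjEnd_mul, mul_inv_cancel, conjEnd_one])
  map_one' := by
    ext e
    exact DFunLike.congr_fun conjEnd_one e
  map_mul' x y := by
    ext e
    exact DFunLike.congr_fun (conjEnd_mul x y) e

theorem conjAct_bracket (x y z : G) :
    conjAct G x (bracket y z) = bracket (x * y * x⁻¹) (x * z * x⁻¹) :=
  conjEnd_bracket x y z

theorem bracket_mul_left (x y z : G) :
    bracket (x * y) z = conjAct G x (bracket y z) * bracket x z := by
  rw [conjAct_bracket, bracket_mul_left']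

theorem bracket_mul_right (x y z : G) :
    bracket x (y * z) = bracket x y * conjAct G y (bracket x z) := by
  rw [← bracket_swap, bracket_mul_left, mul_inv_rev, ← map_inv, bracket_swap, bracket_swap]

theorem conjAct_bracket_eq (x y z : G) :
    conjAct G x (bracket y z) = bracket x ⁅y, z⁆ * bracket y z := by
  rw [conjAct_bracket, bracket_conj']

theorem bracket_one_left (x : G) : bracket 1 x = 1 := by
  have h := bracket_mul_left 1 1 x
  rwa [mul_one, map_one, MulAut.one_apply, eq_comm, mul_eq_left] at h

theorem bracket_one_right (x : G) : bracket x 1 = 1 := by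
  rw [← bracket_swap, bracket_one_left, inv_one]

/-- Expanding `⟨xy, zw⟩` first on the left or first on the right and cancelling the common outer
factors shows that conjugation by `⟨x, z⟩` carries the action of `zx` to that of `xz`. -/
theorem bracket_mul_conjAct (x z : G) (e : ExteriorSquare G) :
    bracket x z * e = conjAct G ⁅x, z⁆ e * bracket x z := by
  have key : ∀ y w : G, conjAct G (x * z) (bracket y w) * bracket x z =
      bracket x z * conjAct G (z * x) (bracket y w) := by
    intro y w
    have h : bracket (x * y) (z * w) = bracket (x * y) (z * w) := rfl
    conv_lhs at h => rw [bracket_mul_left, bracket_mul_right, bracket_mul_right]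
    conv_rhs at h => rw [bracket_mul_right, bracket_mul_left, bracket_mul_left]
    simp only [map_mul, MulAut.mul_apply, mul_assoc] at h ⊢
    have h' := mul_left_cancel h
    simp only [← mul_assoc] at h' ⊢
    exact mul_right_cancel h'
  have hom : ((MulAut.conj (bracket x z)).toMonoidHom.comp (conjAct G (z * x)).toMonoidHom) =
      (conjAct G (x * z)).toMonoidHom :=
    exteriorSquare_hom_ext fun y w => by
      change bracket x z * conjAct G (z * x) (bracket y w) * (bracket x z)⁻¹ = _
      rw [← key y w, mul_inv_cancel_right]
      rfl
  have h := DFunLike.congr_fun hom ((conjAct G (z * x))⁻¹ e)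
  simp only [MonoidHom.comp_apply, MulEquiv.coe_toMonoidHom, MulAut.apply_inv_self,
    MulAut.conj_apply] at h
  rw [← map_inv, ← MulAut.mul_apply, ← map_mul, mul_inv_eq_iff_eq_mul] at h
  rw [h, commutatorElement_def]
  simp [mul_assoc]

/-- The Peiffer identity of the crossed module, extended from brackets to the group they generate.
-/
theorem mul_eq_conjAct_mul (d e : ExteriorSquare G) :
    d * e = conjAct G (boundary G d) e * d := by
  have hd : d ∈ Subgroup.closure {e : ExteriorSquare G | ∃ x y, bracket x y = e} := by
    rw [closure_bracket]; trivial
  induction hd using Subgroup.closure_induction generalizing e with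
  | mem d hd =>
    obtain ⟨x, y, rfl⟩ := hd
    rw [boundary_bracket, bracket_mul_conjAct]
  | one => simp
  | mul a b _ _ ha hb => rw [mul_assoc, hb, ← mul_assoc, ha, map_mul, map_mul, MulAut.mul_apply,
      mul_assoc]
  | inv a _ ha =>
    rw [inv_mul_eq_iff_eq_mul, ← mul_assoc, ha, ← MulAut.mul_apply, ← map_mul]
    simp

theorem conjAct_bracket_of_commute {y z : G} (h : Commute y z) (x : G) :
    conjAct G x (bracket y z) = bracket y z := by
  rw [conjAct_bracket_eq, commutatorElement_eq_one_iff_commute.2 h, bracket_one_right, one_mul]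

theorem bracket_commutator_left (h x : G) :
    bracket ⁅h, x⁆ x = bracket h x * (conjAct G x (bracket h x))⁻¹ := by
  rw [conjAct_bracket_eq, mul_inv_rev, mul_inv_cancel_left, bracket_swap]

theorem bracket_conj_self (h x : G) :
    bracket (h * x * h⁻¹) x = bracket h x * (conjAct G x (bracket h x))⁻¹ := by
  have : h * x * h⁻¹ = ⁅h, x⁆ * x := by simp [commutatorElement_def]
  rw [this, bracket_mul_left, bracket_self, map_one, one_mul, bracket_commutator_left]

/-- Follows from `g x g⁻¹ = [g, x] x` and the Peiffer identity. It reduces brackets of two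
conjugates of `x` to brackets with `x` itself. -/
theorem bracket_conj_right (a g x : G) :
    bracket a (g * x * g⁻¹) = bracket (a * g) x * (bracket g x)⁻¹ := by
  have : g * x * g⁻¹ = ⁅g, x⁆ * x := by simp [commutatorElement_def]
  rw [this, bracket_mul_right, ← boundary_bracket, eq_mul_inv_iff_mul_eq, mul_assoc,
    ← mul_eq_conjAct_mul, bracket_mul_left, conjAct_bracket_eq, boundary_bracket, mul_assoc]

end Bracket

/-! ### Lifting the transposition relations -/

section Lifting

open Equiv Equiv.Perm

variable {α P : Type*} [DecidableEq α] [Group P]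

/-- If `T` lifts the transpositions to elements of `P` that satisfy the conjugation relations of
transpositions, then each word in lifts of transpositions supported on `insert m A` is a word in
lifts of transpositions supported on `A`, followed by at most one lift of a transposition
moving `m`. -/
theorem mem_closure_swap_insert (T : α → α → P)
    (hcomm : ∀ i j, T i j = T j i) (hsq : ∀ i j, i ≠ j → T i j * T i j = 1)
    (hconj : ∀ i j k l, i ≠ j → k ≠ l → T i j * T k l = T (swap i j k) (swap i j l) * T i j)
    (A : Finset α) (m : α) (hm : m ∉ A) (p : P)
    (hp : p ∈ Subgroup.closure {p | ∃ i ∈ insert m A, ∃ j ∈ insert m A, i ≠ j ∧ T i j = p}) :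
    ∃ q ∈ Subgroup.closure {p | ∃ i ∈ A, ∃ j ∈ A, i ≠ j ∧ T i j = p},
      p = q ∨ ∃ j ∈ A, p = q * T j m := by
  set K := Subgroup.closure {p | ∃ i ∈ A, ∃ j ∈ A, i ≠ j ∧ T i j = p}
  have hmem : ∀ i ∈ A, ∀ j ∈ A, i ≠ j → T i j ∈ K := fun i hi j hj h =>
    Subgroup.subset_closure ⟨i, hi, j, hj, h, rfl⟩
  have hne : ∀ i ∈ A, i ≠ m := fun i hi h => hm (h ▸ hi)
  have step : ∀ p : P, (∃ q ∈ K, p = q ∨ ∃ j ∈ A, p = q * T j m) →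
      ∀ i ∈ insert m A, ∀ j ∈ insert m A, i ≠ j →
        ∃ q ∈ K, p * T i j = q ∨ ∃ k ∈ A, p * T i j = q * T k m := by
    have last : ∀ p : P, (∃ q ∈ K, p = q ∨ ∃ j ∈ A, p = q * T j m) →
        ∀ i ∈ A, ∃ q ∈ K, p * T i m = q ∨ ∃ k ∈ A, p * T i m = q * T k m := by
      rintro p ⟨q, hq, rfl | ⟨j, hj, rfl⟩⟩ i hi
      · exact ⟨p, hq, .inr ⟨i, hi, rfl⟩⟩
      · rcases eq_or_ne j i with rfl | hji
        · exact ⟨q, hq, .inl (by rw [mul_assoc, hsq _ _ (hne _ hj), mul_one])⟩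
        -- Two lifts moving `m` merge into one: `T j m * T i m = T i j * T j m`.
        · refine ⟨q * T i j, mul_mem hq (hmem i hi j hj hji.symm), .inr ⟨j, hj, ?_⟩⟩
          rw [mul_assoc, hconj _ _ _ _ (hne _ hj) (hne _ hi), swap_apply_right,
            swap_apply_of_ne_of_ne hji.symm (hne _ hi), mul_assoc]
    intro p hp i hi j hj hij
    rw [Finset.mem_insert] at hi hj
    rcases hi with rfl | hi
    · rcases hj with rfl | hj
      · exact absurd rfl hij
      · rw [hcomm]; exact last p hp j hj
    · rcases hj with rfl | hj
      · exact last p hp i hi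
      · obtain ⟨q, hq, rfl | ⟨k, hk, rfl⟩⟩ := hp
        · exact ⟨p * T i j, mul_mem hq (hmem i hi j hj hij), .inl rfl⟩
        -- The lift moving `m` is pushed to the right past `T i j`, which renames `k` to `swap i j
        -- k`.
        · refine ⟨q * T i j, mul_mem hq (hmem i hi j hj hij), .inr ⟨swap i j k, ?_, ?_⟩⟩
          · rw [swap_apply_def]; split_ifs <;> assumption
          · have h2 := hconj i j (swap i j k) m hij (by
              rw [swap_apply_def]; split_ifs
              exacts [hne _ hj, hne _ hi, hne _ hk])
            rw [swap_apply_of_ne_of_ne (hne _ hi).symm (hne _ hj).symm, swap_apply_self] at h2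
            rw [mul_assoc, mul_assoc, h2]
  induction hp using Subgroup.closure_induction_right with
  | one => exact ⟨1, one_mem _, .inl rfl⟩
  | mul_right x _ y hy ih =>
    obtain ⟨i, hi, j, hj, hij, rfl⟩ := hy
    exact step x ih i hi j hj hij
  | mul_inv_cancel x _ y hy ih =>
    obtain ⟨i, hi, j, hj, hij, rfl⟩ := hy
    rw [inv_eq_of_mul_eq_one_left (hsq i j hij)]
    exact step x ih i hi j hj hij

/-- Induction on the support. A word of the form `q * T j m` cannot lie over the identity: `π q`
fixes `m`, so its image sends `j` to `m`. -/
theorem eq_one_of_mem_closure_swap_lift (T : α → α → P)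
    (hcomm : ∀ i j, T i j = T j i) (hsq : ∀ i j, i ≠ j → T i j * T i j = 1)
    (hconj : ∀ i j k l, i ≠ j → k ≠ l → T i j * T k l = T (swap i j k) (swap i j l) * T i j)
    (π : P →* Perm α) (hπ : ∀ i j, i ≠ j → π (T i j) = swap i j) (A : Finset α) (p : P)
    (hp : p ∈ Subgroup.closure {p | ∃ i ∈ A, ∃ j ∈ A, i ≠ j ∧ T i j = p}) (h1 : π p = 1) :
    p = 1 := by
  induction A using Finset.induction_on generalizing p with
  | empty => simpa using hp
  | insert m A hm ih =>
    obtain ⟨q, hq, rfl | ⟨j, hj, rfl⟩⟩ := mem_closure_swap_insert T hcomm hsq hconj A m hm p hp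
    · exact ih p hq h1
    · exfalso
      have hfix : Subgroup.closure {p | ∃ i ∈ A, ∃ j ∈ A, i ≠ j ∧ T i j = p} ≤
          (MulAction.stabilizer (Perm α) m).comap π := by
        rw [Subgroup.closure_le]
        rintro _ ⟨i, hi, j, hj, hij, rfl⟩
        simp only [SetLike.mem_coe, Subgroup.mem_comap, MulAction.mem_stabilizer_iff, hπ i j hij,
          Perm.smul_def]
        exact swap_apply_of_ne_of_ne (fun h => hm (h ▸ hi)) (fun h => hm (h ▸ hj))
      have hqm : π q m = m := hfix hq
      have hjm : j ≠ m := fun h => hm (h ▸ hj)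
      rw [map_mul, hπ j m hjm] at h1
      have h2 := congrArg (fun f : Perm α => f j) h1
      simp only [Perm.mul_apply, swap_apply_left, Perm.one_apply, hqm] at h2
      exact hjm h2.symm

end Lifting

/-! ### Lifts of conjugates to the semidirect product -/

section Semidirect

variable {G : Type*} [Group G]

variable (G) in
/-- The homomorphism `(e, g) ↦ ∂e * g` on the semidirect product of the exterior square by `G`. -/
def semidirectBoundary : ExteriorSquare G ⋊[conjAct G] G →* G :=
  SemidirectProduct.lift (boundary G) (MonoidHom.id G) fun g =>
    exteriorSquare_hom_ext fun x y => by
      simp [conjAct_bracket, boundary_bracket, commutatorElement_def, mul_assoc]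

/-- The element `⟨g, x⟩ x` of the semidirect product, a lift of `g x g⁻¹`. -/
def conjLift (x g : G) : ExteriorSquare G ⋊[conjAct G] G := ⟨bracket g x, x⟩

theorem semidirectBoundary_inl (e : ExteriorSquare G) :
    semidirectBoundary G (SemidirectProduct.inl e) = boundary G e :=
  SemidirectProduct.lift_inl _ _ _ _

theorem semidirectBoundary_conjLift (x g : G) :
    semidirectBoundary G (conjLift x g) = g * x * g⁻¹ := by
  rw [conjLift, SemidirectProduct.mk_eq_inl_mul_inr, map_mul, semidirectBoundary_inl,
    semidirectBoundary, SemidirectProduct.lift_inr, boundary_bracket]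
  simp [commutatorElement_def]

theorem conjLift_mul_self {x : G} (hx : x * x = 1) (g : G) :
    conjLift x g * conjLift x g = 1 := by
  refine SemidirectProduct.ext ?_ hx
  change bracket g x * conjAct G x (bracket g x) = 1
  rw [← bracket_mul_right, hx, bracket_one_right]

/-- By the Peiffer identity, since `∂⟨g, x⟩ · x = g x g⁻¹`. This is the conjugation relation
required of the lifts. -/
theorem conjLift_mul_conjLift (x g h : G) :
    conjLift x g * conjLift x h = conjLift x (g * x * g⁻¹ * h) * conjLift x g := by
  refine SemidirectProduct.ext ?_ rfl
  change bracket g x * conjAct G x (bracket h x) =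
    bracket (g * x * g⁻¹ * h) x * conjAct G x (bracket g x)
  rw [bracket_mul_left, bracket_conj_self, mul_assoc, inv_mul_cancel_right, mul_eq_conjAct_mul,
    boundary_bracket, ← MulAut.mul_apply, ← map_mul]
  simp [commutatorElement_def]

/-- By `conjLift_mul_conjLift` the right side is the commutator of `conjLift x g` and `conjLift x
h`. -/
theorem inl_bracket_conj (x g h : G) :
    SemidirectProduct.inl (bracket (g * x * g⁻¹) (h * x * h⁻¹)) =
      conjLift x (g * x * g⁻¹ * h) * (conjLift x h)⁻¹ := by
  rw [bracket_conj_right, eq_mul_inv_iff_mul_eq]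
  refine SemidirectProduct.ext ?_ (one_mul x)
  change _ * conjAct G 1 (bracket h x) = _
  rw [map_one, MulAut.one_apply]
  exact inv_mul_cancel_right _ _

/-- Measures how far the lift of `g x g⁻¹` depends on the choice of `g`. -/
theorem conjLift_mul_of_commute {x c : G} (h : Commute c x) (g : G) :
    conjLift x (g * c) = SemidirectProduct.inl (bracket c x) * conjLift x g := by
  refine SemidirectProduct.ext ?_ (one_mul x).symm
  change bracket (g * c) x = bracket c x * conjAct G 1 (bracket g x)
  rw [bracket_mul_left, conjAct_bracket_of_commute h, map_one, MulAut.one_apply]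

theorem inl_bracket_mem_center {x y : G} (h : Commute x y) :
    (SemidirectProduct.inl (bracket x y) : ExteriorSquare G ⋊[conjAct G] G) ∈
      Subgroup.center _ := by
  rw [Subgroup.mem_center_iff]
  rintro ⟨e, g⟩
  refine SemidirectProduct.ext ?_ (by simp)
  change e * conjAct G g (bracket x y) = bracket x y * conjAct G 1 e
  rw [conjAct_bracket_of_commute h, map_one, MulAut.one_apply, mul_eq_conjAct_mul,
    conjAct_bracket_of_commute h]

theorem bracket_mul_self {x y : G} (h : Commute x y) (hx : x * x = 1) :
    bracket x y * bracket x y = 1 := by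
  have h' := bracket_mul_left x x y
  rwa [conjAct_bracket_of_commute h, hx, bracket_one_left, eq_comm] at h'

end Semidirect

/-! ### Brackets of transpositions -/

section Symmetric

open Equiv Equiv.Perm

variable {α : Type*} [DecidableEq α]

theorem swap_commute_swap {a b c d : α} (hac : a ≠ c) (had : a ≠ d) (hbc : b ≠ c) (hbd : b ≠ d) :
    Commute (swap a b) (swap c d) := by
  rw [commute_iff_eq, mul_swap_eq_swap_mul, swap_apply_of_ne_of_ne hac.symm hbc.symm,
    swap_apply_of_ne_of_ne had.symm hbd.symm]

theorem commute_swap_of_fixed {g : Perm α} {a b : α} (ha : g a = a) (hb : g b = b) :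
    Commute g (swap a b) := by
  rw [commute_iff_eq, mul_swap_eq_swap_mul, ha, hb]

theorem fixes_or_exchanges_of_commute_swap {g : Perm α} {a b : α} (hab : a ≠ b)
    (h : Commute g (swap a b)) : (g a = a ∧ g b = b) ∨ (g a = b ∧ g b = a) := by
  have h1 : swap (g a) (g b) = swap a b := by
    rw [swap_apply_apply, h.eq, mul_inv_cancel_right]
  have h2 := congrArg (fun f : Perm α => f (g a)) h1
  have hne : g a ≠ g b := fun e => hab (g.injective e)
  simp only [swap_apply_left] at h2
  by_cases ha : g a = a
  · exact .inl ⟨ha, by rw [h2, ha, swap_apply_left]⟩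
  · by_cases hb : g a = b
    · exact .inr ⟨hb, by rw [h2, hb, swap_apply_right]⟩
    · rw [swap_apply_of_ne_of_ne ha hb] at h2
      exact absurd h2.symm hne

theorem closure_bracket_isSwap [Finite α] :
    Subgroup.closure {e : ExteriorSquare (Perm α) |
      ∃ σ τ : Perm α, σ.IsSwap ∧ τ.IsSwap ∧ bracket σ τ = e} = ⊤ := by
  set K := Subgroup.closure {e : ExteriorSquare (Perm α) |
      ∃ σ τ : Perm α, σ.IsSwap ∧ τ.IsSwap ∧ bracket σ τ = e}
  have conj_isSwap : ∀ g σ : Perm α, σ.IsSwap → (g * σ * g⁻¹).IsSwap := by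
    rintro g _ ⟨i, j, hij, rfl⟩
    exact ⟨g i, g j, fun e => hij (g.injective e), (swap_apply_apply g i j).symm⟩
  have hconj : ∀ g, K ≤ K.comap (conjAct (Perm α) g).toMonoidHom := by
    intro g
    rw [Subgroup.closure_le]
    rintro _ ⟨σ, τ, hσ, hτ, rfl⟩
    exact Subgroup.subset_closure ⟨_, _, conj_isSwap g σ hσ, conj_isSwap g τ hτ,
      (conjAct_bracket g σ τ).symm⟩
  have key : ∀ σ : Perm α, σ.IsSwap → ∀ y, bracket σ y ∈ K := by
    intro σ hσ y
    induction y using swap_induction_on with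
    | one => rw [bracket_one_right]; exact one_mem _
    | swap_mul f i j hij ih =>
      rw [bracket_mul_right]
      exact mul_mem (Subgroup.subset_closure ⟨_, _, hσ, ⟨i, j, hij, rfl⟩, rfl⟩) (hconj _ ih)
  rw [eq_top_iff, ← closure_bracket, Subgroup.closure_le]
  rintro _ ⟨x, y, rfl⟩
  induction x using swap_induction_on with
  | one => rw [bracket_one_left]; exact one_mem _
  | swap_mul f i j hij ih =>
    rw [bracket_mul_left]
    exact mul_mem (hconj _ ih) (key _ ⟨i, j, hij, rfl⟩ y)

/-- The bracket of a transposition with an element of its centralizer is a power of the bracket of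
two disjoint transpositions. -/
theorem bracket_mem_zpowers_of_commute_swap [Finite α] {a b c d : α} (hab : a ≠ b) (hcd : c ≠ d)
    (hac : a ≠ c) (had : a ≠ d) (hbc : b ≠ c) (hbd : b ≠ d) {g : Perm α}
    (hg : Commute g (swap a b)) :
    bracket g (swap a b) ∈ Subgroup.zpowers (bracket (swap a b) (swap c d)) := by
  have hfix : ∀ f : Perm {x : α // x ≠ a ∧ x ≠ b}, ofSubtype f a = a ∧ ofSubtype f b = b :=
    fun f => ⟨ofSubtype_apply_of_not_mem f fun h => h.1 rfl,
      ofSubtype_apply_of_not_mem f fun h => h.2 rfl⟩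
  have hcomm : ∀ f : Perm {x : α // x ≠ a ∧ x ≠ b}, Commute (ofSubtype f) (swap a b) :=
    fun f => commute_swap_of_fixed (hfix f).1 (hfix f).2
  have hswap : bracket (swap c d) (swap a b) ∈
      Subgroup.zpowers (bracket (swap a b) (swap c d)) := by
    rw [← bracket_swap]
    exact inv_mem (Subgroup.mem_zpowers _)
  have hsub : ∀ f : Perm {x : α // x ≠ a ∧ x ≠ b}, bracket (ofSubtype f) (swap a b) ∈
      Subgroup.zpowers (bracket (swap a b) (swap c d)) := by
    intro f
    induction f using swap_induction_on with
    | one => rw [map_one, bracket_one_left]; exact one_mem _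
    | swap_mul f i j hij ih =>
      rw [map_mul, bracket_mul_left, conjAct_bracket_of_commute (hcomm f)]
      refine mul_mem ih ?_
      -- A permutation `e` fixing `a` and `b` carries `(c d)` to `(i j)`; it does not change the
      -- bracket with `(a b)`, because the action fixes brackets of commuting elements.
      obtain ⟨e, he⟩ := isConj_iff.1 (isConj_swap
        (w := (⟨c, hac.symm, hbc.symm⟩ : {x : α // x ≠ a ∧ x ≠ b})) (x := ⟨d, had.symm, hbd.symm⟩)
        (fun h => hcd (congrArg Subtype.val h)) hij)
      have he' := congrArg ofSubtype he
      rw [map_mul, map_mul, map_inv, ofSubtype_swap_eq] at he'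
      have hc := (hcomm e).eq
      rw [← mul_inv_eq_iff_eq_mul] at hc
      rw [← he', ← hc, ← conjAct_bracket,
        conjAct_bracket_of_commute (swap_commute_swap hac had hbc hbd).symm, hc]
      exact hswap
  have hfixed : ∀ g : Perm α, g a = a → g b = b → bracket g (swap a b) ∈
      Subgroup.zpowers (bracket (swap a b) (swap c d)) := by
    intro g ha hb
    have h1 : ∀ x, (g x ≠ a ∧ g x ≠ b) ↔ (x ≠ a ∧ x ≠ b) := fun x => by
      have ha' := g.injective.ne_iff (x := x) (y := a)
      have hb' := g.injective.ne_iff (x := x) (y := b)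
      rw [ha] at ha'
      rw [hb] at hb'
      rw [ha', hb']
    have h2 : ∀ x, g x ≠ x → x ≠ a ∧ x ≠ b := fun x hx =>
      ⟨fun e => hx (by rw [e, ha]), fun e => hx (by rw [e, hb])⟩
    have h3 := hsub (subtypePerm g h1)
    rwa [ofSubtype_subtypePerm h1 h2] at h3
  rcases fixes_or_exchanges_of_commute_swap hab hg with ⟨ha, hb⟩ | ⟨ha, hb⟩
  · exact hfixed g ha hb
  -- Multiplying by `(a b)` makes `g` fix both points and keeps the bracket, as `⟨x, x⟩ = 1`.
  · have h := hfixed (g * swap a b) (by simp [hb]) (by simp [ha])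
    rwa [bracket_mul_left, bracket_self, map_one, one_mul] at h

end Symmetric

/-! ### The kernel of the boundary map -/

section Kernel

open Equiv Equiv.Perm

variable {α : Type*} [DecidableEq α]

/-- The kernel of the boundary map of a symmetric group is generated by the bracket of two disjoint
transpositions. -/
theorem mem_zpowers_of_boundary_eq_one [Finite α] {a b c d : α} (hab : a ≠ b) (hcd : c ≠ d)
    (hac : a ≠ c) (had : a ≠ d) (hbc : b ≠ c) (hbd : b ≠ d) {e : ExteriorSquare (Perm α)}
    (he : boundary (Perm α) e = 1) :
    e ∈ Subgroup.zpowers (bracket (swap a b) (swap c d)) := by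
  classical
  cases nonempty_fintype α
  set t : Perm α := swap a b
  set v := bracket t (swap c d)
  have hv : Commute t (swap c d) := swap_commute_swap hac had hbc hbd
  let N : Subgroup (ExteriorSquare (Perm α) ⋊[conjAct (Perm α)] Perm α) :=
    Subgroup.zpowers (SemidirectProduct.inl v)
  have hNc : N ≤ Subgroup.center _ := by
    rw [Subgroup.zpowers_le]
    exact inl_bracket_mem_center hv
  have hN : N.Normal := ⟨fun n hn g => by
    rwa [Subgroup.mem_center_iff.1 (hNc hn) g, mul_inv_cancel_right]⟩
  have hNinl : ∀ f : ExteriorSquare (Perm α), SemidirectProduct.inl f ∈ N ↔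
      f ∈ Subgroup.zpowers v := by
    intro f
    simp only [N, Subgroup.mem_zpowers_iff, ← map_zpow, SemidirectProduct.inl_inj]
  have hπN : N ≤ (semidirectBoundary (Perm α)).ker := by
    rw [Subgroup.zpowers_le, MonoidHom.mem_ker, semidirectBoundary_inl, boundary_bracket]
    exact commutatorElement_eq_one_iff_commute.2 hv
  let π := QuotientGroup.lift N (semidirectBoundary (Perm α)) hπN
  have hwd : ∀ g h : Perm α, g * t * g⁻¹ = h * t * h⁻¹ →
      QuotientGroup.mk' N (conjLift t g) = QuotientGroup.mk' N (conjLift t h) := by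
    intro g h hgh
    have hc : Commute (h⁻¹ * g) t := by
      rw [commute_iff_eq, mul_assoc, inv_mul_eq_iff_eq_mul, mul_inv_eq_iff_eq_mul.1 hgh]
      simp only [mul_assoc]
    have h1 := conjLift_mul_of_commute hc h
    rw [mul_inv_cancel_left] at h1
    have h2 : QuotientGroup.mk' N (SemidirectProduct.inl (bracket (h⁻¹ * g) t)) = 1 :=
      (QuotientGroup.eq_one_iff _).2 ((hNinl _).2
        (bracket_mem_zpowers_of_commute_swap hab hcd hac had hbc hbd hc))
    rw [h1, map_mul, h2, one_mul]
  have hex : ∀ i j, i ≠ j → ∃ g : Perm α, g * t * g⁻¹ = swap i j := fun i j hij =>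
    isConj_iff.1 (isConj_swap hab hij)
  -- By `hwd` the chosen conjugator is immaterial; the default `1` is taken only off the conjugacy
  -- class of `t`.
  let T' : Perm α → (ExteriorSquare (Perm α) ⋊[conjAct (Perm α)] Perm α) ⧸ N := fun σ =>
    if h : ∃ g : Perm α, g * t * g⁻¹ = σ then QuotientGroup.mk' N (conjLift t h.choose) else 1
  have hT' : ∀ g : Perm α, T' (g * t * g⁻¹) = QuotientGroup.mk' N (conjLift t g) := by
    intro g
    have h : ∃ g' : Perm α, g' * t * g'⁻¹ = g * t * g⁻¹ := ⟨g, rfl⟩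
    simp only [T', dif_pos h]
    exact hwd _ _ h.choose_spec
  let T : α → α → (ExteriorSquare (Perm α) ⋊[conjAct (Perm α)] Perm α) ⧸ N :=
    fun i j => T' (swap i j)
  have htt : t * t = 1 := swap_mul_self a b
  have hsq : ∀ i j, i ≠ j → T i j * T i j = 1 := by
    intro i j hij
    obtain ⟨g, hg⟩ := hex i j hij
    simp only [T, ← hg, hT']
    rw [← map_mul, conjLift_mul_self htt, map_one]
  have hconj : ∀ i j k l, i ≠ j → k ≠ l →
      T i j * T k l = T (swap i j k) (swap i j l) * T i j := by
    intro i j k l hij hkl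
    obtain ⟨g, hg⟩ := hex i j hij
    obtain ⟨h, hh⟩ := hex k l hkl
    have hgh : swap (swap i j k) (swap i j l) =
        (g * t * g⁻¹ * h) * t * (g * t * g⁻¹ * h)⁻¹ := by
      rw [swap_apply_apply, ← hg, ← hh]
      simp only [mul_inv_rev, mul_assoc]
    simp only [T, hgh]
    rw [← hg, ← hh, hT', hT', hT', ← map_mul, conjLift_mul_conjLift, map_mul]
  have hπ : ∀ i j, i ≠ j → π (T i j) = swap i j := by
    intro i j hij
    obtain ⟨g, hg⟩ := hex i j hij
    simp only [T, ← hg, hT']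
    exact semidirectBoundary_conjLift t g
  set H := Subgroup.closure {p | ∃ i ∈ (Finset.univ : Finset α), ∃ j ∈ (Finset.univ : Finset α),
    i ≠ j ∧ T i j = p}
  have hmem : ∀ i j, i ≠ j → T i j ∈ H := fun i j hij =>
    Subgroup.subset_closure ⟨i, Finset.mem_univ i, j, Finset.mem_univ j, hij, rfl⟩
  have hall : ∀ f : ExteriorSquare (Perm α),
      QuotientGroup.mk' N (SemidirectProduct.inl f) ∈ H := by
    intro f
    have htop : (⊤ : Subgroup (ExteriorSquare (Perm α))) ≤
        H.comap ((QuotientGroup.mk' N).comp SemidirectProduct.inl) := by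
      rw [← closure_bracket_isSwap, Subgroup.closure_le]
      rintro _ ⟨_, _, ⟨i, j, hij, rfl⟩, ⟨k, l, hkl, rfl⟩, rfl⟩
      obtain ⟨g, hg⟩ := hex i j hij
      obtain ⟨h, hh⟩ := hex k l hkl
      -- This commutator of lifts is the image of the bracket of the two transpositions.
      have h1 : T i j * T k l * (T i j)⁻¹ * (T k l)⁻¹ ∈ H :=
        mul_mem (mul_mem (mul_mem (hmem i j hij) (hmem k l hkl)) (inv_mem (hmem i j hij)))
          (inv_mem (hmem k l hkl))
      simp only [T, ← hg, ← hh, hT', ← map_mul, ← map_inv] at h1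
      rw [conjLift_mul_conjLift, mul_inv_cancel_right, ← inl_bracket_conj, hg, hh] at h1
      exact h1
    exact htop (Subgroup.mem_top f)
  have h1 := eq_one_of_mem_closure_swap_lift T (fun i j => congrArg T' (swap_comm i j)) hsq hconj π
    hπ Finset.univ _ (hall e) ((semidirectBoundary_inl e).trans he)
  exact (hNinl e).1 ((QuotientGroup.eq_one_iff _).1 h1)

theorem eq_one_or_eq_of_boundary_eq_one [Finite α] {a b c d : α} (hab : a ≠ b) (hcd : c ≠ d)
    (hac : a ≠ c) (had : a ≠ d) (hbc : b ≠ c) (hbd : b ≠ d) {e : ExteriorSquare (Perm α)}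
    (he : boundary (Perm α) e = 1) :
    e = 1 ∨ e = bracket (swap a b) (swap c d) := by
  obtain ⟨k, rfl⟩ := mem_zpowers_of_boundary_eq_one hab hcd hac had hbc hbd he
  have h2 : bracket (swap a b) (swap c d) ^ (2 : ℤ) = 1 := by
    rw [zpow_two]
    exact bracket_mul_self (swap_commute_swap hac had hbc hbd) (swap_mul_self a b)
  dsimp only
  rcases Int.even_or_odd' k with ⟨m, rfl | rfl⟩
  · exact .inl (by rw [zpow_mul, h2, one_zpow])
  · exact .inr (by rw [zpow_add, zpow_mul, h2, one_zpow, one_mul, zpow_one])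

end Kernel

/-! ### Products of pairs and the conclusion -/

theorem mk_prod_ofFn_pair {G : Type*} [Group G] {r : ℕ} (σ τ : Fin r → G) :
    (QuotientGroup.mk (List.ofFn fun i => pair (σ i) (τ i)).prod : ExteriorSquare G) =
      (List.ofFn fun i => bracket (σ i) (τ i)).prod := by
  change QuotientGroup.mk' (B G) _ = _
  rw [map_list_prod, List.map_ofFn]
  rfl

theorem boundary_prod_ofFn_bracket {G : Type*} [Group G] {r : ℕ} (σ τ : Fin r → G) :
    boundary G (List.ofFn fun i => bracket (σ i) (τ i)).prod =
      (List.ofFn fun i => ⁅σ i, τ i⁆).prod := by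
  rw [map_list_prod, List.map_ofFn]
  congr 2
  funext i
  exact boundary_bracket _ _

end FormalPairs

theorem mainTheorem7 (n : ℕ) (hn : 4 ≤ n) (r s : ℕ)
    (σ τ : Fin r → Equiv.Perm (Fin n)) (σ' τ' : Fin s → Equiv.Perm (Fin n))
    (h : (List.ofFn fun i => ⁅σ i, τ i⁆).prod = (List.ofFn fun j => ⁅σ' j, τ' j⁆).prod) :
    ∃ k ∈ ({0, 1} : Set ℕ),
      FormalPairs.Equivalent
        (List.ofFn fun i => FormalPairs.pair (σ i) (τ i)).prod
        (FormalPairs.u n hn ^ k * (List.ofFn fun j => FormalPairs.pair (σ' j) (τ' j)).prod) := by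
  -- The hypothesis says that the quotient of the two products of brackets lies in the kernel of the
  -- boundary map.
  rw [← FormalPairs.boundary_prod_ofFn_bracket, ← FormalPairs.boundary_prod_ofFn_bracket,
    ← mul_inv_eq_one, ← map_inv, ← map_mul] at h
  have key := FormalPairs.eq_one_or_eq_of_boundary_eq_one
    (a := (⟨0, by omega⟩ : Fin n)) (b := ⟨1, by omega⟩) (c := ⟨2, by omega⟩) (d := ⟨3, by omega⟩)
    (by simp) (by simp) (by simp) (by simp) (by simp) (by simp) h
  unfold FormalPairs.Equivalent
  rcases key with h1 | h1
  · refine ⟨0, by simp, ?_⟩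
    rw [pow_zero, one_mul, FormalPairs.mk_prod_ofFn_pair, FormalPairs.mk_prod_ofFn_pair]
    exact mul_inv_eq_one.1 h1
  · refine ⟨1, by simp, ?_⟩
    rw [pow_one, QuotientGroup.mk_mul, FormalPairs.mk_prod_ofFn_pair,
      FormalPairs.mk_prod_ofFn_pair]
    exact mul_inv_eq_iff_eq_mul.1 h1
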